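/- Let $K$ be a field of characteristic $0$, let $n\ge 0$ and $R=K[x_1,\dots,x_n]$, and let $W=R\langle\partial_1,\dots,\partial_n\rangle$ be the Weyl algebra of linear differential operators with polynomial coefficients, acting on $R$. Let $\mathfrak m\subset R$ be any maximal ideal (not necessarily a rational point), with residue field $\kappa(\mathfrak m)=R/\mathfrak m$, and let $W_{\kappa(\mathfrak m)}=\kappa(\mathfrak m)\otimes_R W$, where $W$ is an $R$-module by multiplication on the left. For $f\in R$ and $D=\sum_j a_j\otimes D_j\in W_{\kappa(\mathfrak m)}$, write $D\cdot f\in\mathfrak m$ if the value of $D$ applied to $f$ vanishes at $\mathfrak m$, i.e. $\sum_j a_j\,\overline{D_j(f)}=0$ in $\kappa(\mathfrak m)$, where $\overline{g}$ denotes the class of $g\in R$ in $\kappa(\mathfrak m)$. For an ideal $J\subseteq R$ the local dual space of $J$ at $\mathfrak m$ is $$D_{\mathfrak m}[J]=\{D\in W_{\kappa(\mathfrak m)} \mid D\cdot f\in\mathfrak m \text{ for all } f\in J\}.$$ Lemma. For every ideal $I\subseteq R$ and every integer $d\ge 1$, with the truncated local dual space $D^{(d-1)}_{\mathfrak m}[I]:=D_{\mathfrak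 m}[I+\mathfrak m^d]$, one has $$I+\mathfrak m^d=\{f\in R \mid D\cdot f\in\mathfrak m \text{ for all } D\in D^{(d-1)}_{\mathfrak m}[I]\}.$$ -/

import Mathlib

open scoped TensorProduct

noncomputable section

namespace LocalDual

variable (K : Type*) [Field K] (n : ℕ)

/-- The Weyl algebra `W = K[x₁, …, xₙ]⟨∂₁, …, ∂ₙ⟩` of linear differential operators with polynomial
coefficients: the algebra of `K`-linear endomorphisms of `K[x₁, …, xₙ]` generated by the
multiplications by polynomials and the partial derivatives. -/
def weylAlgebra : Subalgebra K (Module.End K (MvPolynomial (Fin n) K)) :=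
  Algebra.adjoin K
    (Set.range (Algebra.lmul K (MvPolynomial (Fin n) K)) ∪
      Set.range fun i : Fin n => (MvPolynomial.pderiv (R := K) i).toLinearMap)

variable {K n}

theorem smul_mem_weylAlgebra (f : MvPolynomial (Fin n) K)
    {D : Module.End K (MvPolynomial (Fin n) K)} (hD : D ∈ weylAlgebra K n) :
    f • D ∈ weylAlgebra K n := by
  have h : f • D = Algebra.lmul K (MvPolynomial (Fin n) K) f * D := by
    exact LinearMap.ext fun _ => rfl
  rw [h]
  exact mul_mem (Algebra.subset_adjoin (Or.inl ⟨f, rfl⟩)) hD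

/-- The left action `(f, D) ↦ f D` of a polynomial on a differential operator,
`(f D)(g) = f * D(g)`. -/
instance : SMul (MvPolynomial (Fin n) K) (weylAlgebra K n) :=
  ⟨fun f D => ⟨f • D.1, smul_mem_weylAlgebra f D.2⟩⟩

/-- The left module structure of the Weyl algebra over the polynomial ring. -/
instance : Module (MvPolynomial (Fin n) K) (weylAlgebra K n) :=
  Function.Injective.module (MvPolynomial (Fin n) K)
    (weylAlgebra K n).val.toLinearMap.toAddMonoidHom Subtype.val_injective (fun _ _ => rfl)

/-- Application of differential operators to the polynomial `f`: the map `D ↦ D(f)`, which is linear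
for the left module structure. -/
def applyTo (f : MvPolynomial (Fin n) K) :
    weylAlgebra K n →ₗ[MvPolynomial (Fin n) K] MvPolynomial (Fin n) K where
  toFun D := D.1 f
  map_add' _ _ := rfl
  map_smul' _ _ := rfl

/-- The local differential space `W_{κ(m)} = κ(m) ⊗_R W` at `m`, where `R = K[x₁, …, xₙ]`,
`κ(m) = R ⧸ m`, and the tensor product uses the left `R`-module structure of `W`. -/
abbrev LocalDiffSpace (m : Ideal (MvPolynomial (Fin n) K)) : Type _ :=
  (MvPolynomial (Fin n) K ⧸ m) ⊗[MvPolynomial (Fin n) K] (weylAlgebra K n)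

/-- The value at `m` of the operators of `W_{κ(m)}` applied to the polynomial `f`: the `κ(m)`-linear
map `W_{κ(m)} → κ(m)` with `a ⊗ D ↦ a * (D(f) mod m)`. The condition `D · f ∈ m` says that this
value is zero. -/
def valueAt (m : Ideal (MvPolynomial (Fin n) K)) (f : MvPolynomial (Fin n) K) :
    LocalDiffSpace m →ₗ[MvPolynomial (Fin n) K ⧸ m] (MvPolynomial (Fin n) K ⧸ m) :=
  (TensorProduct.AlgebraTensorModule.rid (MvPolynomial (Fin n) K) (MvPolynomial (Fin n) K ⧸ m)
      (MvPolynomial (Fin n) K ⧸ m)).toLinearMap ∘ₗ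
    (applyTo f).baseChange (MvPolynomial (Fin n) K ⧸ m)

theorem valueAt_tmul (m : Ideal (MvPolynomial (Fin n) K)) (f : MvPolynomial (Fin n) K)
    (a : MvPolynomial (Fin n) K ⧸ m) (D : weylAlgebra K n) :
    valueAt m f (a ⊗ₜ D) = a * Ideal.Quotient.mk m (D.1 f) := by
  rw [mul_comm]
  simp only [valueAt, LinearMap.comp_apply, LinearMap.baseChange_tmul, LinearEquiv.coe_coe,
    TensorProduct.AlgebraTensorModule.rid_tmul]
  rfl

/-- The local dual space `D_m[I]`: all operators in `W_{κ(m)}` that vanish at `m` when applied to any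
polynomial in `I`. -/
def localDualSpace (m I : Ideal (MvPolynomial (Fin n) K)) :
    Submodule (MvPolynomial (Fin n) K ⧸ m) (LocalDiffSpace m) :=
  ⨅ f ∈ I, LinearMap.ker (valueAt m f)

theorem mem_localDualSpace {m I : Ideal (MvPolynomial (Fin n) K)} {D : LocalDiffSpace m} :
    D ∈ localDualSpace m I ↔ ∀ f ∈ I, valueAt m f D = 0 := by
  simp [localDualSpace, Submodule.mem_iInf]

end LocalDual

end

namespace LocalDual

open MvPolynomial

variable {K : Type*} [Field K] {n : ℕ}

/-! Let `J = I + m ^ d` and `f ∉ J`; an operator killing `J` but not `f` is needed. The ideal `m /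
J` of `A = R / J` is nilpotent, so in characteristic zero `A` contains a coefficient field `s : κ(m)
→ A` (`exists_coefficientField`). This replaces the rational point: some `κ(m)`-linear functional
`l` on `A` is nonzero at `f`, and each `x_i - s(x̄_i)` is nilpotent. Taylor expansion at the point
`s(x̄_i)` (`taylor_expansion`) therefore writes `l` as the value at `m` of a finite combination of
divided powers of the `∂_i`. It kills `J` because `l` factors through `A`. -/

theorem pderiv_mem_weylAlgebra (i : Fin n) :
    (pderiv (R := K) i).toLinearMap ∈ weylAlgebra K n :=
  Algebra.subset_adjoin (Or.inr ⟨i, rfl⟩)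

theorem pderiv_pow_monomial (i : Fin n) (k : ℕ) (β : Fin n →₀ ℕ) (a : K) :
    ((pderiv (R := K) i).toLinearMap ^ k) (monomial β a) =
      monomial (β - Finsupp.single i k) (a * ((β i).descFactorial k : K)) := by
  induction k with
  | zero => simp
  | succ k ih =>
    rw [pow_succ', Module.End.mul_apply, ih, Derivation.coeFn_coe, pderiv_monomial]
    congr 1
    · rw [tsub_tsub, ← Finsupp.single_add]
    · rw [Finsupp.tsub_apply, Finsupp.single_eq_same, Nat.descFactorial_succ]
      push_cast
      ring

/-- Existence of the divided power operators `∏ i ∈ s, ∂ᵢ ^ kᵢ / kᵢ!` in the Weyl algebra. -/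
theorem exists_dividedPower [CharZero K] (s : Finset (Fin n)) (k : Fin n → ℕ) :
    ∃ D ∈ weylAlgebra K n, ∀ (β : Fin n →₀ ℕ) (a : K),
      D (monomial β a) = monomial (β - ∑ i ∈ s, Finsupp.single i (k i))
        (a * ∏ i ∈ s, ((β i).choose (k i) : K)) := by
  classical
  induction s using Finset.induction_on with
  | empty => exact ⟨1, one_mem _, fun β a => by simp⟩
  | insert i s hi ih =>
    obtain ⟨D, hD, h⟩ := ih
    refine ⟨((k i).factorial : K)⁻¹ • ((pderiv (R := K) i).toLinearMap ^ (k i) * D),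
      Subalgebra.smul_mem _ (mul_mem (pow_mem (pderiv_mem_weylAlgebra i) _) hD) _, fun β a => ?_⟩
    have hβ : (β - ∑ j ∈ s, Finsupp.single j (k j)) i = β i := by
      rw [Finsupp.tsub_apply, Finsupp.finsetSum_apply, Finset.sum_eq_zero, tsub_zero]
      intro j hj
      exact Finsupp.single_eq_of_ne (fun e => hi (e ▸ hj))
    have hk : ((k i).factorial : K) ≠ 0 := Nat.cast_ne_zero.mpr (Nat.factorial_ne_zero _)
    rw [LinearMap.smul_apply, Module.End.mul_apply, h, pderiv_pow_monomial, hβ, smul_monomial,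
      Finset.sum_insert hi, Finset.prod_insert hi, tsub_tsub, add_comm (Finsupp.single i (k i)),
      Nat.descFactorial_eq_factorial_mul_choose]
    congr 1
    push_cast
    rw [smul_eq_mul]
    field_simp

/-- The divided power operator `∏ i, ∂ᵢ ^ kᵢ / kᵢ!`. -/
noncomputable def dividedPower [CharZero K] (k : Fin n → ℕ) : weylAlgebra K n :=
  ⟨_, (exists_dividedPower Finset.univ k).choose_spec.1⟩

theorem dividedPower_monomial [CharZero K] (k : Fin n → ℕ) (β : Fin n →₀ ℕ) (a : K) :
    (dividedPower (K := K) k).1 (monomial β a) =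
      monomial (β - ∑ i, Finsupp.single i (k i)) (a * ∏ i, ((β i).choose (k i) : K)) :=
  (exists_dividedPower Finset.univ k).choose_spec.2 β a

/-- The range of summation does not depend on `b`, so one operator serves all monomials. Terms with
`j > b`, where `b - j` truncates, have zero binomial coefficient. -/
theorem add_pow_eq_sum_range_of_pow_eq_zero {A : Type*} [CommRing A] {ε : A} {d : ℕ}
    (hε : ε ^ d = 0) (c : A) (b : ℕ) :
    (ε + c) ^ b = ∑ j ∈ Finset.range d, ε ^ j * c ^ (b - j) * (b.choose j : A) := by
  rw [add_pow]
  trans ∑ j ∈ Finset.range (max (b + 1) d), ε ^ j * c ^ (b - j) * (b.choose j : A)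
  · refine Finset.sum_subset (Finset.range_mono (le_max_left _ _)) fun j _ hj => ?_
    rw [Nat.choose_eq_zero_of_lt (not_lt.mp fun h => hj (Finset.mem_range.mpr h)), Nat.cast_zero,
      mul_zero]
  · refine (Finset.sum_subset (Finset.range_mono (le_max_right _ _)) fun j _ hj => ?_).symm
    rw [pow_eq_zero_of_le (by simpa using hj) hε, zero_mul, zero_mul]

/-- Taylor expansion of a polynomial at a point that differs from `c` by nilpotent elements. -/
theorem taylor_expansion [CharZero K] {A : Type*} [CommRing A] [Algebra K A]
    (φ : MvPolynomial (Fin n) K →ₐ[K] A) (c : Fin n → A) (d : ℕ)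
    (h : ∀ i, (φ (X i) - c i) ^ d = 0) (g : MvPolynomial (Fin n) K) :
    φ g = ∑ k ∈ Fintype.piFinset fun _ : Fin n => Finset.range d,
      aeval c ((dividedPower (K := K) k).1 g) * ∏ i, (φ (X i) - c i) ^ k i := by
  induction g using MvPolynomial.induction_on' with
  | add p q hp hq =>
    rw [map_add, hp, hq, ← Finset.sum_add_distrib]
    refine Finset.sum_congr rfl fun k _ => ?_
    rw [map_add, map_add, add_mul]
  | monomial β a =>
    have hφ : φ = aeval fun i => φ (X i) := MvPolynomial.algHom_ext fun i => by simp
    have hX (i : Fin n) : φ (X i) ^ β i = ∑ j ∈ Finset.range d,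
        (φ (X i) - c i) ^ j * c i ^ (β i - j) * ((β i).choose j : A) := by
      rw [← add_pow_eq_sum_range_of_pow_eq_zero (h i), sub_add_cancel]
    conv_lhs => rw [hφ, aeval_monomial, Finsupp.prod_fintype _ _ fun _ => pow_zero _]
    simp_rw [hX]
    rw [Finset.prod_univ_sum, Finset.mul_sum]
    refine Finset.sum_congr rfl fun k _ => ?_
    rw [dividedPower_monomial, aeval_monomial, Finsupp.prod_fintype _ _ fun _ => pow_zero _,
      map_mul, map_prod, Finset.prod_mul_distrib, Finset.prod_mul_distrib]
    have hk (i : Fin n) : (β - ∑ j, Finsupp.single j (k j)) i = β i - k i := by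
      rw [Finsupp.tsub_apply, Finsupp.finsetSum_apply,
        Finset.sum_eq_single i (fun j _ hj => Finsupp.single_eq_of_ne hj.symm) (by simp),
        Finsupp.single_eq_same]
    simp_rw [hk, map_natCast]
    ring

/-- A functional on a `κ(m)`-algebra infinitesimally close to `κ(m)` is given by an operator of
`W_{κ(m)}`. -/
theorem exists_valueAt_eq [CharZero K] (m : Ideal (MvPolynomial (Fin n) K))
    {A : Type*} [CommRing A] [Algebra K A] (φ : MvPolynomial (Fin n) K →ₐ[K] A)
    (s : (MvPolynomial (Fin n) K ⧸ m) →ₐ[K] A) (d : ℕ)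
    (h : ∀ i, (φ (X i) - s (Ideal.Quotient.mk m (X i))) ^ d = 0)
    (l : A →+ MvPolynomial (Fin n) K ⧸ m) (hl : ∀ a x, l (s a * x) = a * l x) :
    ∃ D : LocalDiffSpace m, ∀ g, valueAt m g D = l (φ g) := by
  have hc (g : MvPolynomial (Fin n) K) :
      aeval (fun i => s (Ideal.Quotient.mk m (X i))) g = s (Ideal.Quotient.mk m g) := by
    have : aeval (fun i => s (Ideal.Quotient.mk m (X i))) = s.comp (Ideal.Quotient.mkₐ K m) :=
      MvPolynomial.algHom_ext fun i => by simp
    rw [this]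
    rfl
  -- Apply `l` to the Taylor expansion: its coefficients lie in the image of `s` and come out of
  -- `l`.
  refine ⟨∑ k ∈ Fintype.piFinset fun _ : Fin n => Finset.range d,
    l (∏ i, (φ (X i) - s (Ideal.Quotient.mk m (X i))) ^ k i) ⊗ₜ dividedPower k, fun g => ?_⟩
  rw [taylor_expansion φ _ d h g, map_sum, map_sum]
  refine Finset.sum_congr rfl fun k _ => ?_
  rw [valueAt_tmul, hc, mul_comm, hl]

/-- Through `s`, `A` is an `F`-vector space, and linear functionals separate its points. -/
theorem exists_functional_ne_zero {F A : Type*} [Field F] [CommRing A] (s : F →+* A) {x : A}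
    (hx : x ≠ 0) : ∃ l : A →+ F, (∀ a y, l (s a * y) = a * l y) ∧ l x ≠ 0 := by
  let _ : Algebra F A := s.toAlgebra
  obtain ⟨l, hl⟩ := Module.Projective.exists_dual_ne_zero F hx
  exact ⟨l.toAddMonoidHom, fun a y => l.map_smul a y, hl⟩

/-- A surjection with nilpotent kernel onto an essentially finitely generated extension field has a
section in characteristic zero. -/
theorem exists_coefficientField {K F A : Type*} [Field K] [CharZero K] [Field F] [Algebra K F]
    [Algebra.EssFiniteType K F] [CommRing A] [Algebra K A] (ρ : A →ₐ[K] F) (hρ : Function.Surjective ρ)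
    (hnil : IsNilpotent (RingHom.ker (ρ : A →+* F))) : ∃ s : F →ₐ[K] A, ∀ x, ρ (s x) = x := by
  have : Algebra.FormallySmooth K F := Algebra.FormallySmooth.of_perfectField
  exact ⟨Algebra.FormallySmooth.liftOfSurjective (AlgHom.id K F) ρ hρ hnil, fun x =>
    Algebra.FormallySmooth.liftOfSurjective_apply _ _ _ _ x⟩

theorem ker_factor_pow_eq_bot {R : Type*} [CommRing R] {J m : Ideal R} (hJm : J ≤ m) {d : ℕ}
    (hJ : m ^ d ≤ J) : RingHom.ker (Ideal.Quotient.factor hJm) ^ d = ⊥ := by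
  rw [Ideal.Quotient.factor_ker, ← Ideal.map_pow, Ideal.map_eq_bot_iff_le_ker, Ideal.mk_ker]
  exact hJ

/-- An ideal `J` containing a power of the maximal ideal `m` is cut out by its local dual space at
`m`. -/
theorem exists_mem_localDualSpace [CharZero K] (m : Ideal (MvPolynomial (Fin n) K))
    [hm : m.IsMaximal] {J : Ideal (MvPolynomial (Fin n) K)} {d : ℕ} (hJ : m ^ d ≤ J)
    {f : MvPolynomial (Fin n) K} (hf : f ∉ J) :
    ∃ D ∈ localDualSpace m J, valueAt m f D ≠ 0 := by
  have hJm : J ≤ m := by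
    -- The only maximal ideal containing `m ^ d` is `m`.
    obtain ⟨M, hM, hJM⟩ := J.exists_le_maximal fun h => hf (h ▸ Submodule.mem_top)
    have hmM : m ≤ M := Ideal.IsPrime.le_of_pow_le (hJ.trans hJM)
    rwa [hm.eq_of_le hM.ne_top hmM]
  have hker := ker_factor_pow_eq_bot hJm hJ
  let _ : Field (MvPolynomial (Fin n) K ⧸ m) := Ideal.Quotient.field m
  obtain ⟨s, hs⟩ := exists_coefficientField (Ideal.Quotient.factorₐ K hJm)
    (Ideal.Quotient.factor_surjective hJm) ⟨d, hker⟩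
  obtain ⟨l, hl, hlf⟩ := exists_functional_ne_zero s.toRingHom
    (mt Ideal.Quotient.eq_zero_iff_mem.mp hf)
  obtain ⟨D, hD⟩ := exists_valueAt_eq m (Ideal.Quotient.mkₐ K J) s d (fun i => by
    -- Since `s` is a section, `x_i - s(x̄_i)` lies in the kernel of `A → κ(m)`, whose `d`-th power
    -- is zero.
    rw [← Ideal.mem_bot, ← hker]
    refine Ideal.pow_mem_pow (RingHom.mem_ker.mpr ?_) d
    rw [map_sub]
    exact sub_eq_zero.mpr (hs (Ideal.Quotient.mk m (X i))).symm) l hl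
  refine ⟨D, mem_localDualSpace.mpr fun g hg => ?_, by rw [hD]; exact hlf⟩
  rw [hD, Ideal.Quotient.mkₐ_eq_mk, Ideal.Quotient.eq_zero_iff_mem.mpr hg, map_zero]

end LocalDual

theorem mainTheorem2 {K : Type*} [Field K] [CharZero K] (n : ℕ)
    (m : Ideal (MvPolynomial (Fin n) K)) (hm : m.IsMaximal)
    (I : Ideal (MvPolynomial (Fin n) K)) (d : ℕ) (hd : 1 ≤ d) :
    ((I + m ^ d : Ideal (MvPolynomial (Fin n) K)) : Set (MvPolynomial (Fin n) K)) =
      {f | ∀ D ∈ LocalDual.localDualSpace m (I + m ^ d), LocalDual.valueAt m f D = 0} := by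
  refine Set.Subset.antisymm (fun f hf D hD => LocalDual.mem_localDualSpace.mp hD f hf) ?_
  intro f hf
  by_contra hfJ
  obtain ⟨D, hD, hDf⟩ := LocalDual.exists_mem_localDualSpace m le_sup_right hfJ
  exact hDf (hf D hD)
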